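/- Let $d_1,d_2\ge 1$ and let $f:\mathbb R^{d_1}\times\mathbb R^{d_2}\to\mathbb R$ be differentiable. Suppose that: (i) there is $l>0$ with $\|\nabla_x f(x_1,y_1)-\nabla_x f(x_2,y_2)\|\le l(\|x_1-x_2\|+\|y_1-y_2\|)$ and $\|\nabla_y f(x_1,y_1)-\nabla_y f(x_2,y_2)\|\le l(\|x_1-x_2\|+\|y_1-y_2\|)$ for all $x_1,x_2,y_1,y_2$; (ii) for every $x$ the maximum $\Phi(x)=\max_y f(x,y)$ is attained, and there is $\mu>0$ with $\|\nabla_y f(x,y)\|^2\ge 2\mu\,[\Phi(x)-f(x,y)]$ for all $x,y$ (the Polyak–Łojasiewicz condition in $y$); (iii) $\Phi^*=\min_x\Phi(x)$ exists and is finite. Put $L=l+\frac{l^2}{2\mu}$ and $\kappa=\frac{l}{\mu}$. Let $\varepsilon>0$, and let $\alpha,\beta>0$ satisfy $$\beta\le\frac1{4d_2L},\qquad \alpha\le\min\Big\{\frac{\beta}{32\kappa^2},\frac1{10d_1L}\Big\}.$$ Put $\theta_1=\big(5d_1L+\frac{3}{2\alpha}+\frac32L+d_2L\big)d_1^2L^2\alpha^2$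 and take the smoothing radii $$\mu_1=\frac{\sqrt{\alpha}\,\varepsilon}{2\sqrt{\theta_1}},\qquad \mu_2=\frac{\sqrt\alpha\,\varepsilon}{\sqrt{3\beta}\,d_2L}.$$ Let $u_0,u_1,\dots$ and $v_0,v_1,\dots$ be mutually independent random vectors, each $u_t$ uniformly distributed on the unit sphere of $\mathbb R^{d_1}$ and each $v_t$ uniformly distributed on the unit sphere of $\mathbb R^{d_2}$. From a deterministic starting point $(x_0,y_0)$, the ZO-AGDA algorithm generates, for $t=0,1,2,\dots$, $$x_{t+1}=x_t-\alpha\,\frac{f(x_t+\mu_1u_t,y_t)-f(x_t,y_t)}{\mu_1/d_1}\,u_t,\qquad y_{t+1}=y_t+\beta\,\frac{f(x_{t+1},y_t+\mu_2v_t)-f(x_{t+1},y_t)}{\mu_2/d_2}\,v_t .$$ Then $\Phi$ is differentiable, $\mathbb E\|\nabla\Phi(x_t)\|<\infty$ for all $t$, and $T(\varepsilon):=\min\{t\ge0:\ \mathbb E\|\nabla\Phi(x_t)\|\le\varepsilon\}$ exists and satisfies $$T(\varepsilon)\le\frac{4\,[\,3\Phi(x_0)-f(x_0,y_0)-2\Phi^*\,]}{\alpha\,\varepsilon^2}.$$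 (For fixed $\alpha$ and $\beta$, only $\varepsilon^2$ in this bound depends on $\varepsilon$, so $T(\varepsilon)=\mathcal O(\varepsilon^{-2})$.) -/

import Mathlib

open MeasureTheory ProbabilityTheory

/-- The uniform probability distribution on the unit sphere of `ℝ^d`, as a measure on `ℝ^d`:
the normalized surface measure, pushed forward along the inclusion of the sphere. -/
noncomputable def uniformSphere (d : ℕ) : Measure (EuclideanSpace ℝ (Fin d)) :=
  (((volume : Measure (EuclideanSpace ℝ (Fin d))).toSphere Set.univ)⁻¹ •
    (volume : Measure (EuclideanSpace ℝ (Fin d))).toSphere).map Subtype.val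

section Minimax

/-- The primal function `Φ(x) = max_y f(x, y)`; it is the maximum whenever that is attained. -/
noncomputable def primalFun {X Y : Type*} (f : X → Y → ℝ) (x : X) : ℝ :=
  ⨆ y, f x y

/-- The partial gradient `∇_x f(x, y)`. -/
noncomputable def gradX {d₁ d₂ : ℕ}
    (f : EuclideanSpace ℝ (Fin d₁) → EuclideanSpace ℝ (Fin d₂) → ℝ)
    (x : EuclideanSpace ℝ (Fin d₁)) (y : EuclideanSpace ℝ (Fin d₂)) :
    EuclideanSpace ℝ (Fin d₁) :=
  gradient (fun x' => f x' y) x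

/-- The partial gradient `∇_y f(x, y)`. -/
noncomputable def gradY {d₁ d₂ : ℕ}
    (f : EuclideanSpace ℝ (Fin d₁) → EuclideanSpace ℝ (Fin d₂) → ℝ)
    (x : EuclideanSpace ℝ (Fin d₁)) (y : EuclideanSpace ℝ (Fin d₂)) :
    EuclideanSpace ℝ (Fin d₂) :=
  gradient (fun y' => f x y') y

/-- `f` is differentiable and both partial gradients are Lipschitz continuous with constant `l`
(with respect to the sum of the norms of the two blocks). -/
structure HasLipschitzGradients {d₁ d₂ : ℕ}
    (f : EuclideanSpace ℝ (Fin d₁) → EuclideanSpace ℝ (Fin d₂) → ℝ) (l : ℝ) : Prop where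
  differentiable : Differentiable ℝ
    (fun p : EuclideanSpace ℝ (Fin d₁) × EuclideanSpace ℝ (Fin d₂) => f p.1 p.2)
  gradX_le : ∀ x₁ x₂ y₁ y₂,
    ‖gradX f x₁ y₁ - gradX f x₂ y₂‖ ≤ l * (‖x₁ - x₂‖ + ‖y₁ - y₂‖)
  gradY_le : ∀ x₁ x₂ y₁ y₂,
    ‖gradY f x₁ y₁ - gradY f x₂ y₂‖ ≤ l * (‖x₁ - x₂‖ + ‖y₁ - y₂‖)

/-- For every `x` the maximum of `f(x, ·)` is attained, and `f` satisfies the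
Polyak-Łojasiewicz condition in `y` with constant `μ`. -/
structure IsPLInY {d₁ d₂ : ℕ}
    (f : EuclideanSpace ℝ (Fin d₁) → EuclideanSpace ℝ (Fin d₂) → ℝ) (μ : ℝ) : Prop where
  max_attained : ∀ x, ∃ ystar, ∀ y, f x y ≤ f x ystar
  pl : ∀ x y, 2 * μ * (primalFun f x - f x y) ≤ ‖gradY f x y‖ ^ 2

/-- The zeroth-order estimator of `∇_x f(x, y)` in direction `u` with smoothing radius `μ₁`. -/
noncomputable def zoGradX {d₁ d₂ : ℕ}
    (f : EuclideanSpace ℝ (Fin d₁) → EuclideanSpace ℝ (Fin d₂) → ℝ) (μ₁ : ℝ)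
    (x : EuclideanSpace ℝ (Fin d₁)) (y : EuclideanSpace ℝ (Fin d₂))
    (u : EuclideanSpace ℝ (Fin d₁)) : EuclideanSpace ℝ (Fin d₁) :=
  ((f (x + μ₁ • u) y - f x y) / (μ₁ / (d₁ : ℝ))) • u

/-- The zeroth-order estimator of `∇_y f(x, y)` in direction `v` with smoothing radius `μ₂`. -/
noncomputable def zoGradY {d₁ d₂ : ℕ}
    (f : EuclideanSpace ℝ (Fin d₁) → EuclideanSpace ℝ (Fin d₂) → ℝ) (μ₂ : ℝ)
    (x : EuclideanSpace ℝ (Fin d₁)) (y : EuclideanSpace ℝ (Fin d₂))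
    (v : EuclideanSpace ℝ (Fin d₂)) : EuclideanSpace ℝ (Fin d₂) :=
  ((f x (y + μ₂ • v) - f x y) / (μ₂ / (d₂ : ℝ))) • v

/-- The iterates `(x_t, y_t)` of ZO-AGDA started at `(x₀, y₀)`, for given sequences of
directions `u`, `v`: a descent step in `x`, then an ascent step in `y` at the new `x`. -/
noncomputable def zoAGDA {d₁ d₂ : ℕ}
    (f : EuclideanSpace ℝ (Fin d₁) → EuclideanSpace ℝ (Fin d₂) → ℝ) (α β μ₁ μ₂ : ℝ)
    (x₀ : EuclideanSpace ℝ (Fin d₁)) (y₀ : EuclideanSpace ℝ (Fin d₂))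
    (u : ℕ → EuclideanSpace ℝ (Fin d₁)) (v : ℕ → EuclideanSpace ℝ (Fin d₂)) :
    ℕ → EuclideanSpace ℝ (Fin d₁) × EuclideanSpace ℝ (Fin d₂)
  | 0 => (x₀, y₀)
  | t + 1 =>
    let p := zoAGDA f α β μ₁ μ₂ x₀ y₀ u v t
    let xnext := p.1 - α • zoGradX f μ₁ p.1 p.2 (u t)
    (xnext, p.2 + β • zoGradY f μ₂ xnext p.2 (v t))

end Minimax

/-! The proof follows the potential V = E[3Φ(x) - f(x, y)] = E[2Φ(x) + (Φ(x) - f(x, y))], which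
never falls below 2Φ*. Two costs threaten its decrease: the descent direction approximates ∇_x f
rather than ∇Φ, and finite differences are inexact.

The first cost is paid by the ascent step. The Polyak-Łojasiewicz condition gives Φ a quadratic
model with constant l + l²/μ, and then ‖∇_x f - ∇Φ‖² ≤ 3κ²‖∇_y f‖²
(`sq_norm_gradX_sub_gradient_primalFun_le`). The ascent gains β/2 ‖∇_y f‖² in expectation, up to
noise, and α ≤ β/(32κ²) makes this enough.

The second cost needs no unbiasedness and no smoothed function. Along a unit vector u the difference
quotient is within lμ₁/2 of ⟨∇_x f, u⟩, so the change of the potential is bounded pointwise by a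
quadratic form in inner products with u (`descent_step_le`, `ascent_step_ge`). Averaging uses only
E⟨A, u⟩² = ‖A‖²/d and the independence of each direction from the past.

Together, V drops by α E‖∇Φ(x_t)‖² up to a noise below αε²/4. While E‖∇Φ(x_t)‖ > ε it therefore
drops by at least αε²/4, which bounds the number of such steps. -/

/-! ### Second moments of the uniform distribution on the sphere -/

theorem uniformSphere_apply {d : ℕ} {s : Set (EuclideanSpace ℝ (Fin d))} (hs : MeasurableSet s) :
    uniformSphere d s =
      ((volume : Measure (EuclideanSpace ℝ (Fin d))).toSphere Set.univ)⁻¹ *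
        (d * volume (Set.image2 (fun (c : ℝ) w => c • w) (Set.Ioo (0 : ℝ) 1)
          (s ∩ Metric.sphere 0 1))) := by
  rw [uniformSphere, Measure.map_apply measurable_subtype_coe hs, Measure.smul_apply,
    Measure.toSphere_apply' _ (measurable_subtype_coe hs), Subtype.image_preimage_coe,
    finrank_euclideanSpace_fin, smul_eq_mul, Set.inter_comm]
  rfl

theorem isProbabilityMeasure_uniformSphere {d : ℕ} (hd : 0 < d) :
    IsProbabilityMeasure (uniformSphere d) := by
  have : Nonempty (Fin d) := ⟨⟨0, hd⟩⟩
  refine ⟨?_⟩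
  rw [uniformSphere, Measure.map_apply measurable_subtype_coe MeasurableSet.univ, Set.preimage_univ,
    Measure.smul_apply, smul_eq_mul, ENNReal.inv_mul_cancel]
  · rw [Ne, Measure.measure_univ_eq_zero]
    exact Measure.toSphere_ne_zero _
  · exact measure_ne_top _ _

theorem ae_norm_eq_one_uniformSphere (d : ℕ) : ∀ᵐ w ∂(uniformSphere d), ‖w‖ = 1 := by
  have hm : MeasurableSet {w : EuclideanSpace ℝ (Fin d) | ‖w‖ = 1} :=
    measurableSet_eq_fun measurable_norm measurable_const
  rw [uniformSphere, ae_map_iff measurable_subtype_coe.aemeasurable hm]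
  exact Filter.Eventually.of_forall fun w => by simp

/-- The surface measure of a set is proportional to the volume of the cone over it, and linear
isometries commute with forming cones and preserve volume. -/
theorem map_linearIsometryEquiv_uniformSphere {d : ℕ}
    (R : EuclideanSpace ℝ (Fin d) ≃ₗᵢ[ℝ] EuclideanSpace ℝ (Fin d)) :
    (uniformSphere d).map R = uniformSphere d := by
  ext s hs
  have hRm : Measurable R := R.continuous.measurable
  rw [Measure.map_apply hRm hs, uniformSphere_apply (hRm hs), uniformSphere_apply hs]
  congr 2
  have key : Set.image2 (fun (c : ℝ) w => c • w) (Set.Ioo (0 : ℝ) 1)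
        (R ⁻¹' s ∩ Metric.sphere 0 1) =
      R ⁻¹' Set.image2 (fun (c : ℝ) w => c • w) (Set.Ioo (0 : ℝ) 1) (s ∩ Metric.sphere 0 1) := by
    ext w
    simp only [Set.mem_image2, Set.mem_inter_iff, Set.mem_preimage, mem_sphere_zero_iff_norm]
    constructor
    · rintro ⟨c, hc, z, ⟨hz, hz1⟩, rfl⟩
      exact ⟨c, hc, R z, ⟨hz, by simpa using hz1⟩, by simp⟩
    · rintro ⟨c, hc, z, ⟨hz, hz1⟩, h⟩
      refine ⟨c, hc, R.symm z, ⟨by simpa using hz, by simpa using hz1⟩, ?_⟩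
      rw [← map_smul, h]
      simp
  rw [key]
  -- For a measurable equivalence the cone itself need not be shown measurable.
  exact (LinearIsometryEquiv.measurePreserving R).measure_preimage_equiv
    (f := R.toHomeomorph.toMeasurableEquiv) _

theorem integrable_inner_sq_uniformSphere {d : ℕ} (hd : 0 < d) (A : EuclideanSpace ℝ (Fin d)) :
    Integrable (fun w => inner ℝ A w ^ 2) (uniformSphere d) := by
  have := isProbabilityMeasure_uniformSphere hd
  refine Integrable.of_bound (C := ‖A‖ ^ 2) (by fun_prop) ?_
  filter_upwards [ae_norm_eq_one_uniformSphere d] with w hw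
  have h := abs_real_inner_le_norm A w
  rw [hw, mul_one] at h
  rw [Real.norm_eq_abs, abs_pow]
  gcongr

theorem integral_inner_sq_congr_norm {d : ℕ} {A B : EuclideanSpace ℝ (Fin d)} (h : ‖A‖ = ‖B‖) :
    ∫ w, inner ℝ A w ^ 2 ∂(uniformSphere d) = ∫ w, inner ℝ B w ^ 2 ∂(uniformSphere d) := by
  obtain ⟨R, hR⟩ : ∃ R : EuclideanSpace ℝ (Fin d) ≃ₗᵢ[ℝ] EuclideanSpace ℝ (Fin d), R A = B :=
    ⟨_, Submodule.reflection_sub h⟩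
  rw [← hR]
  conv_rhs => rw [← map_linearIsometryEquiv_uniformSphere R]
  rw [integral_map R.continuous.measurable.aemeasurable
    (Continuous.aestronglyMeasurable (by fun_prop))]
  simp [LinearIsometryEquiv.inner_map_map]

/-- By symmetry the second moment depends only on ‖A‖, so all vectors ‖A‖ • b i of a scaled
orthonormal basis share it; by Parseval these d equal moments sum to ‖A‖². -/
theorem integral_inner_sq_uniformSphere {d : ℕ} (hd : 0 < d) (A : EuclideanSpace ℝ (Fin d)) :
    ∫ w, inner ℝ A w ^ 2 ∂(uniformSphere d) = ‖A‖ ^ 2 / d := by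
  have := isProbabilityMeasure_uniformSphere hd
  have hd' : (d : ℝ) ≠ 0 := by positivity
  let b := EuclideanSpace.basisFun (Fin d) ℝ
  have hb : ∀ i, ∫ w, inner ℝ (‖A‖ • b i) w ^ 2 ∂(uniformSphere d) =
      ∫ w, inner ℝ A w ^ 2 ∂(uniformSphere d) := fun i =>
    integral_inner_sq_congr_norm (by simp [norm_smul, b.norm_eq_one])
  have hsum : ∑ i, ∫ w, inner ℝ (‖A‖ • b i) w ^ 2 ∂(uniformSphere d) = ‖A‖ ^ 2 := by
    rw [← integral_finsetSum _ fun i _ => integrable_inner_sq_uniformSphere hd _]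
    rw [integral_congr_ae (g := fun _ => ‖A‖ ^ 2)]
    · simp
    filter_upwards [ae_norm_eq_one_uniformSphere d] with w hw
    simp_rw [real_inner_smul_left, mul_pow, ← Finset.mul_sum]
    rw [b.sum_sq_inner_right, hw]
    simp
  simp_rw [hb] at hsum
  rw [Finset.sum_const, Finset.card_univ, Fintype.card_fin, nsmul_eq_mul] at hsum
  rw [eq_div_iff hd', mul_comm, hsum]

/-! ### Quadratic models -/

/-- The descent lemma, in two-sided form. -/
theorem abs_sub_sub_inner_gradient_le {E : Type*} [NormedAddCommGroup E] [InnerProductSpace ℝ E]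
    [CompleteSpace E] {g : E → ℝ} {l : ℝ} (hg : Differentiable ℝ g)
    (hlip : ∀ x z, ‖gradient g x - gradient g z‖ ≤ l * ‖x - z‖) (x h : E) :
    |g (x + h) - g x - inner ℝ (gradient g x) h| ≤ l / 2 * ‖h‖ ^ 2 := by
  have hd : ∀ s : ℝ, HasDerivAt (fun s : ℝ => g (x + s • h) - g x - s * inner ℝ (gradient g x) h)
      (inner ℝ (gradient g (x + s • h)) h - inner ℝ (gradient g x) h) s := by
    intro s
    have h1 : HasDerivAt (fun s : ℝ => x + s • h) h s := by
      simpa using ((hasDerivAt_id s).smul_const h).const_add x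
    have h2 := (hg (x + s • h)).hasGradientAt.hasFDerivAt.comp_hasDerivAt s h1
    refine HasDerivAt.congr_deriv
      ((h2.sub_const (g x)).sub ((hasDerivAt_id s).mul_const (inner ℝ (gradient g x) h))) ?_
    simp
  have hB : ∀ s : ℝ, HasDerivAt (fun s : ℝ => l / 2 * ‖h‖ ^ 2 * s ^ 2) (l * ‖h‖ ^ 2 * s) s := by
    intro s
    refine HasDerivAt.congr_deriv ((hasDerivAt_pow 2 s).const_mul (l / 2 * ‖h‖ ^ 2)) ?_
    push_cast
    ring
  -- The remainder along the segment vanishes at 0 and has derivative at most l‖h‖²s, so it stays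
  -- below l/2 ‖h‖² s² up to s = 1.
  have := image_norm_le_of_norm_deriv_right_le_deriv_boundary (a := (0 : ℝ)) (b := 1)
    (fun s _ => (hd s).continuousAt.continuousWithinAt) (fun s _ => (hd s).hasDerivWithinAt)
    (by simp) hB (fun s hs => ?_) (Set.right_mem_Icc.2 zero_le_one)
  · simpa using this
  · rw [← inner_sub_left]
    refine (abs_real_inner_le_norm _ _).trans ?_
    have h1 := hlip (x + s • h) x
    rw [add_sub_cancel_left, norm_smul, Real.norm_eq_abs, abs_of_nonneg hs.1] at h1
    calc _ ≤ l * (s * ‖h‖) * ‖h‖ := by gcongr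
      _ = _ := by ring

/-- A nonnegative function with a quadratic upper model satisfies `‖∇g‖² ≤ 2 M g`. -/
theorem sq_norm_le_of_nonneg_of_le_quadratic {E : Type*} [NormedAddCommGroup E]
    [InnerProductSpace ℝ E] {g : E → ℝ} {M : ℝ} (hM : 0 < M) (hg : ∀ z, 0 ≤ g z) {x p : E}
    (hx : ∀ h, g (x + h) ≤ g x + inner ℝ p h + M / 2 * ‖h‖ ^ 2) :
    ‖p‖ ^ 2 ≤ 2 * M * g x := by
  -- The increment -p/M minimizes the quadratic model.
  have h := (hg _).trans (hx (-(M⁻¹ • p)))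
  rw [inner_neg_right, real_inner_smul_right, real_inner_self_eq_norm_sq, norm_neg, norm_smul,
    Real.norm_eq_abs, abs_of_pos (inv_pos.2 hM)] at h
  have e : g x + -(M⁻¹ * ‖p‖ ^ 2) + M / 2 * (M⁻¹ * ‖p‖) ^ 2 = g x - ‖p‖ ^ 2 / (2 * M) := by
    field_simp
    ring
  rw [e, sub_nonneg, div_le_iff₀ (by positivity)] at h
  linarith

/-! ### Smoothness of the primal function -/

section Primal

variable {d₁ d₂ : ℕ} {f : EuclideanSpace ℝ (Fin d₁) → EuclideanSpace ℝ (Fin d₂) → ℝ} {l μ : ℝ}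

theorem HasLipschitzGradients.differentiable_left (hf : HasLipschitzGradients f l)
    (y : EuclideanSpace ℝ (Fin d₂)) : Differentiable ℝ fun x => f x y :=
  hf.differentiable.comp (differentiable_id.prodMk (differentiable_const y))

theorem HasLipschitzGradients.differentiable_right (hf : HasLipschitzGradients f l)
    (x : EuclideanSpace ℝ (Fin d₁)) : Differentiable ℝ fun y => f x y :=
  hf.differentiable.comp ((differentiable_const x).prodMk differentiable_id)

theorem HasLipschitzGradients.abs_left_le (hf : HasLipschitzGradients f l)
    (x h : EuclideanSpace ℝ (Fin d₁)) (y : EuclideanSpace ℝ (Fin d₂)) :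
    |f (x + h) y - f x y - inner ℝ (gradX f x y) h| ≤ l / 2 * ‖h‖ ^ 2 :=
  abs_sub_sub_inner_gradient_le (hf.differentiable_left y)
    (fun x₁ x₂ => by simpa [gradX] using hf.gradX_le x₁ x₂ y y) x h

theorem HasLipschitzGradients.abs_right_le (hf : HasLipschitzGradients f l)
    (x : EuclideanSpace ℝ (Fin d₁)) (y h : EuclideanSpace ℝ (Fin d₂)) :
    |f x (y + h) - f x y - inner ℝ (gradY f x y) h| ≤ l / 2 * ‖h‖ ^ 2 :=
  abs_sub_sub_inner_gradient_le (hf.differentiable_right x)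
    (fun y₁ y₂ => by simpa [gradY] using hf.gradY_le x x y₁ y₂) y h

theorem continuous_of_norm_sub_le {E F G : Type*} [NormedAddCommGroup E] [NormedAddCommGroup F]
    [NormedAddCommGroup G] {g : E → F → G} {l : ℝ}
    (h : ∀ x₁ x₂ y₁ y₂, ‖g x₁ y₁ - g x₂ y₂‖ ≤ l * (‖x₁ - x₂‖ + ‖y₁ - y₂‖)) :
    Continuous fun p : E × F => g p.1 p.2 := by
  rw [continuous_iff_continuousAt]
  rintro ⟨x, y⟩
  rw [ContinuousAt, tendsto_iff_norm_sub_tendsto_zero]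
  refine squeeze_zero (fun _ => norm_nonneg _) (fun p => h p.1 x p.2 y) ?_
  have : Continuous fun p : E × F => l * (‖p.1 - x‖ + ‖p.2 - y‖) := by fun_prop
  simpa using this.tendsto (x, y)

theorem HasLipschitzGradients.continuous_gradX (hf : HasLipschitzGradients f l) :
    Continuous fun p : EuclideanSpace ℝ (Fin d₁) × EuclideanSpace ℝ (Fin d₂) => gradX f p.1 p.2 :=
  continuous_of_norm_sub_le hf.gradX_le

theorem HasLipschitzGradients.continuous_gradY (hf : HasLipschitzGradients f l) :
    Continuous fun p : EuclideanSpace ℝ (Fin d₁) × EuclideanSpace ℝ (Fin d₂) => gradY f p.1 p.2 :=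
  continuous_of_norm_sub_le hf.gradY_le

theorem IsPLInY.le_primalFun (hf : IsPLInY f μ) (x : EuclideanSpace ℝ (Fin d₁))
    (y : EuclideanSpace ℝ (Fin d₂)) : f x y ≤ primalFun f x := by
  obtain ⟨z, hz⟩ := hf.max_attained x
  exact le_ciSup ⟨f x z, Set.forall_mem_range.2 hz⟩ y

theorem IsPLInY.exists_eq_primalFun (hf : IsPLInY f μ) (x : EuclideanSpace ℝ (Fin d₁)) :
    ∃ y, f x y = primalFun f x := by
  obtain ⟨z, hz⟩ := hf.max_attained x
  exact ⟨z, le_antisymm (hf.le_primalFun x z) (ciSup_le hz)⟩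

theorem IsPLInY.gradY_eq_zero (hf : IsPLInY f μ) {x : EuclideanSpace ℝ (Fin d₁)}
    {y : EuclideanSpace ℝ (Fin d₂)} (hy : f x y = primalFun f x) : gradY f x y = 0 := by
  have hmax : IsLocalMax (fun y => f x y) y :=
    Filter.Eventually.of_forall fun z => (hf.le_primalFun x z).trans_eq hy.symm
  rw [gradY, gradient, hmax.fderiv_eq_zero, map_zero]

/-- With y frozen at a maximizer for x, f(·, y) lies below Φ and touches it at x. The gap at x + h
is at most ‖∇_y f(x + h, y)‖²/(2μ) by Polyak-Łojasiewicz, and that gradient vanishes at x, hence has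
norm at most l‖h‖. No regularity of the choice of maximizer is needed. -/
theorem primalFun_sub_le_of_max (hf : HasLipschitzGradients f l) (hPL : IsPLInY f μ) (hμ : 0 < μ)
    {x : EuclideanSpace ℝ (Fin d₁)} {y : EuclideanSpace ℝ (Fin d₂)} (hy : f x y = primalFun f x)
    (h : EuclideanSpace ℝ (Fin d₁)) :
    |primalFun f (x + h) - primalFun f x - inner ℝ (gradX f x y) h| ≤
      (l + l ^ 2 / μ) / 2 * ‖h‖ ^ 2 := by
  have h1 := abs_le.1 (hf.abs_left_le x h y)
  have h2 := hPL.le_primalFun (x + h) y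
  have h3 := hPL.pl (x + h) y
  have h4 := hf.gradY_le (x + h) x y y
  rw [hPL.gradY_eq_zero hy, sub_zero, sub_self, norm_zero, add_zero, add_sub_cancel_left] at h4
  have h5 : ‖gradY f (x + h) y‖ ^ 2 ≤ l ^ 2 * ‖h‖ ^ 2 := by
    rw [← mul_pow]
    gcongr
  have h6 : primalFun f (x + h) - f (x + h) y ≤ l ^ 2 / μ / 2 * ‖h‖ ^ 2 := by
    have e : l ^ 2 / μ / 2 * ‖h‖ ^ 2 = (l ^ 2 * ‖h‖ ^ 2) / (2 * μ) := by field_simp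
    rw [e, le_div_iff₀ (by positivity)]
    linarith
  have h7 : 0 ≤ l ^ 2 / μ / 2 * ‖h‖ ^ 2 := by positivity
  rw [abs_le]
  constructor <;> linarith [h1.1, h1.2]

theorem hasGradientAt_primalFun (hf : HasLipschitzGradients f l) (hPL : IsPLInY f μ) (hμ : 0 < μ)
    {x : EuclideanSpace ℝ (Fin d₁)} {y : EuclideanSpace ℝ (Fin d₂)} (hy : f x y = primalFun f x) :
    HasGradientAt (primalFun f) (gradX f x y) x := by
  rw [hasGradientAt_iff_isLittleO_nhds_zero]
  have h2 : (fun h : EuclideanSpace ℝ (Fin d₁) => ‖h‖ ^ 2) =o[nhds 0] fun h => h :=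
    Asymptotics.isLittleO_norm_pow_id one_lt_two
  refine (Asymptotics.IsBigO.of_bound ((l + l ^ 2 / μ) / 2) ?_).trans_isLittleO h2
  refine Filter.Eventually.of_forall fun h => ?_
  simpa using primalFun_sub_le_of_max hf hPL hμ hy h

theorem differentiable_primalFun (hf : HasLipschitzGradients f l) (hPL : IsPLInY f μ)
    (hμ : 0 < μ) : Differentiable ℝ (primalFun f) := fun x =>
  let ⟨_, hy⟩ := hPL.exists_eq_primalFun x
  (hasGradientAt_primalFun hf hPL hμ hy).differentiableAt

theorem primalFun_add_le (hf : HasLipschitzGradients f l) (hPL : IsPLInY f μ) (hμ : 0 < μ)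
    (x h : EuclideanSpace ℝ (Fin d₁)) :
    primalFun f (x + h) ≤ primalFun f x + inner ℝ (gradient (primalFun f) x) h +
      (l + l ^ 2 / μ) / 2 * ‖h‖ ^ 2 := by
  obtain ⟨y, hy⟩ := hPL.exists_eq_primalFun x
  rw [(hasGradientAt_primalFun hf hPL hμ hy).gradient]
  linarith [(abs_le.1 (primalFun_sub_le_of_max hf hPL hμ hy h)).2]

/-- The Polyak-Łojasiewicz inequality controls the error of `∇_x f` as a proxy of `∇Φ`. -/
theorem sq_norm_gradX_sub_gradient_primalFun_le (hf : HasLipschitzGradients f l)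
    (hPL : IsPLInY f μ) (hl : 0 < l) (hμ : 0 < μ) (x : EuclideanSpace ℝ (Fin d₁))
    (y : EuclideanSpace ℝ (Fin d₂)) :
    ‖gradX f x y - gradient (primalFun f) x‖ ^ 2 ≤ 3 * (l / μ) ^ 2 * ‖gradY f x y‖ ^ 2 := by
  -- The gap Φ - f(·, y) is nonnegative; its model constant adds l + l²/μ from Φ and l from f.
  have h1 : ‖gradient (primalFun f) x - gradX f x y‖ ^ 2 ≤
      2 * (2 * l + l ^ 2 / μ) * (primalFun f x - f x y) :=
    sq_norm_le_of_nonneg_of_le_quadratic (g := fun x => primalFun f x - f x y) (by positivity)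
      (fun z => sub_nonneg.2 (hPL.le_primalFun z y)) fun h => by
        rw [inner_sub_left]
        linarith [primalFun_add_le hf hPL hμ x h, (abs_le.1 (hf.abs_left_le x h y)).1]
  have h2 : ‖-gradY f x y‖ ^ 2 ≤ 2 * l * (primalFun f x - f x y) :=
    sq_norm_le_of_nonneg_of_le_quadratic (g := fun y => primalFun f x - f x y) hl
      (fun z => sub_nonneg.2 (hPL.le_primalFun x z)) fun h => by
        rw [inner_neg_left]
        linarith [(abs_le.1 (hf.abs_right_le x y h)).1]
  have h3 := hPL.pl x y
  rw [norm_neg] at h2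
  rw [norm_sub_rev]
  set N := ‖gradY f x y‖ ^ 2
  set q := primalFun f x - f x y
  have hκ : 0 < l / μ := by positivity
  obtain ⟨k, hk⟩ : ∃ k, k = l / μ := ⟨_, rfl⟩
  have hlk : l = k * μ := by rw [hk]; field_simp
  -- This is κ ≥ 1 in a form that also covers N = 0; it turns 2κ + κ² into 3κ².
  have h4 : N ≤ k * N := by
    calc N ≤ k * (2 * μ * q) := by rw [hlk] at h2; linarith
      _ ≤ k * N := by rw [← hk] at hκ; gcongr
  rw [← hk] at hκ ⊢
  calc _ ≤ 2 * (2 * l + l ^ 2 / μ) * q := h1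
    _ = (2 * k + k ^ 2) * (2 * μ * q) := by rw [hlk]; field_simp
    _ ≤ (2 * k + k ^ 2) * N := by gcongr
    _ = 2 * k * N + k ^ 2 * N := by ring
    _ ≤ 2 * k * (k * N) + k ^ 2 * N := by gcongr
    _ = _ := by ring

end Primal

/-! ### Integrability on compact sets and difference quotients -/

theorem integrable_of_continuous_of_ae_mem_isCompact {Ω A : Type*} [MeasurableSpace Ω]
    [TopologicalSpace A] [MeasurableSpace A] [OpensMeasurableSpace A] {P : Measure Ω}
    [IsFiniteMeasure P] {Z : Ω → A} (hZ : Measurable Z) {K : Set A} (hK : IsCompact K)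
    (hZK : ∀ᵐ ω ∂P, Z ω ∈ K) {F : A → ℝ} (hF : Continuous F) :
    Integrable (fun ω => F (Z ω)) P := by
  obtain ⟨C, hC⟩ := hK.exists_bound_of_continuousOn hF.continuousOn
  refine Integrable.of_bound (C := C) (hF.measurable.comp hZ).aestronglyMeasurable ?_
  filter_upwards [hZK] with ω hω using hC _ hω

theorem integrable_uniformSphere_of_continuous {d : ℕ} (hd : 0 < d)
    {F : EuclideanSpace ℝ (Fin d) → ℝ} (hF : Continuous F) : Integrable F (uniformSphere d) := by
  have := isProbabilityMeasure_uniformSphere hd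
  refine integrable_of_continuous_of_ae_mem_isCompact (Z := id) measurable_id
    (isCompact_sphere 0 1) ?_ hF
  filter_upwards [ae_norm_eq_one_uniformSphere d] with w hw
  simpa using hw

theorem exists_sq_sub_inner_le_of_abs_sub_sub_le {E : Type*} [NormedAddCommGroup E]
    [InnerProductSpace ℝ E] {g : E → ℝ} {l m : ℝ} {x p u : E} (hm : 0 < m)
    (hg : ∀ h, |g (x + h) - g x - inner ℝ p h| ≤ l / 2 * ‖h‖ ^ 2) (hu : ‖u‖ = 1) (d : ℝ) :
    ∃ s, (g (x + m • u) - g x) / (m / d) = d * s ∧ (s - inner ℝ p u) ^ 2 ≤ l ^ 2 * m ^ 2 / 4 := by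
  refine ⟨(g (x + m • u) - g x) / m, by rw [div_div_eq_mul_div]; ring, ?_⟩
  have h := hg (m • u)
  rw [real_inner_smul_right, norm_smul, hu, mul_one, Real.norm_eq_abs, sq_abs] at h
  have e : (g (x + m • u) - g x) / m - inner ℝ p u =
      (g (x + m • u) - g x - m * inner ℝ p u) / m := by field_simp
  rw [e, div_pow, div_le_iff₀ (by positivity), ← sq_abs]
  calc _ ≤ (l / 2 * m ^ 2) ^ 2 := by gcongr
    _ = _ := by ring

/-! ### One-step inequalities, pointwise and averaged -/

section Steps

variable {d₁ d₂ : ℕ} {f : EuclideanSpace ℝ (Fin d₁) → EuclideanSpace ℝ (Fin d₂) → ℝ} {l μ : ℝ}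

theorem HasLipschitzGradients.ascent_step_ge (hf : HasLipschitzGradients f l) {β m : ℝ}
    (hβ : 0 < β) (hd : 0 < d₂) (hβl : l * β * d₂ ≤ 1 / 4) (hm : 0 < m)
    (x : EuclideanSpace ℝ (Fin d₁)) (y v : EuclideanSpace ℝ (Fin d₂)) (hv : ‖v‖ = 1) :
    f x y + β * d₂ * (inner ℝ (gradY f x y) v ^ 2 / 2 - 5 / 16 * (l ^ 2 * m ^ 2)) ≤
      f x (y + β • zoGradY f m x y v) := by
  obtain ⟨s, hs, hr⟩ := exists_sq_sub_inner_le_of_abs_sub_sub_le hm (hf.abs_right_le x y) hv d₂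
  rw [zoGradY, hs, smul_smul]
  have h := (abs_le.1 (hf.abs_right_le x y ((β * (d₂ * s)) • v))).1
  rw [real_inner_smul_right, norm_smul, hv, mul_one, Real.norm_eq_abs, sq_abs] at h
  set q := inner ℝ (gradY f x y) v
  have hd' : (0 : ℝ) < d₂ := by positivity
  have h1 : l / 2 * (β * (d₂ * s)) ^ 2 ≤ β * d₂ * (s ^ 2 / 8) := by
    calc _ = β * d₂ * (l * β * d₂ * (s ^ 2 / 2)) := by ring
      _ ≤ β * d₂ * (1 / 4 * (s ^ 2 / 2)) := by gcongr
      _ = _ := by ring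
  have h2 : β * d₂ * (q ^ 2 / 2 - 5 / 16 * (l ^ 2 * m ^ 2)) ≤ β * d₂ * (s * q - s ^ 2 / 8) := by
    refine mul_le_mul_of_nonneg_left ?_ (by positivity)
    -- With r = s - q and r² ≤ l²m²/4, the right side exceeds the left by at least (q + 2r)²/4 + (q
    -- - r)²/8.
    nlinarith [sq_nonneg (q + 2 * (s - q)), sq_nonneg (q - (s - q))]
  linarith

/-- The term β/2 ‖∇_y f‖² on the left is the expected gain of the ascent step that follows, taken at
the new x. Half of its coefficient survives the return to the old x and is kept to pay for the error
∇_x f - ∇Φ. -/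
theorem HasLipschitzGradients.descent_step_le (hf : HasLipschitzGradients f l)
    (hPL : IsPLInY f μ) (hl : 0 < l) (hμ : 0 < μ) {α β m : ℝ} (hα : 0 < α) (hβ : 0 < β)
    (hd : 0 < d₁) (hβl : β * l ≤ 1 / 4)
    (hαl : α * d₁ * (3 * (l + l ^ 2 / μ) + 5 / 4 * l) ≤ 3 / 5) (hm : 0 < m)
    (x : EuclideanSpace ℝ (Fin d₁)) (y : EuclideanSpace ℝ (Fin d₂))
    (u : EuclideanSpace ℝ (Fin d₁)) (hu : ‖u‖ = 1) :
    3 * primalFun f (x - α • zoGradX f m x y u) - f (x - α • zoGradX f m x y u) y -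
        β / 2 * ‖gradY f (x - α • zoGradX f m x y u) y‖ ^ 2 ≤
      3 * primalFun f x - f x y - β / 4 * ‖gradY f x y‖ ^ 2 +
        α * d₁ * (23 / 10 * inner ℝ (gradX f x y - gradient (primalFun f) x) u ^ 2 -
          inner ℝ (gradient (primalFun f) x) u ^ 2 + 13 / 25 * (l ^ 2 * m ^ 2)) := by
  obtain ⟨s, hs, hr⟩ := exists_sq_sub_inner_le_of_abs_sub_sub_le (g := fun x => f x y) hm
    (fun h => hf.abs_left_le x h y) hu d₁
  have hz : x - α • zoGradX f m x y u = x + (-(α * (d₁ * s))) • u := by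
    rw [zoGradX, hs, smul_smul, neg_smul, sub_eq_add_neg]
  rw [hz]
  have hΦ := primalFun_add_le hf hPL hμ x ((-(α * (d₁ * s))) • u)
  have h := (abs_le.1 (hf.abs_left_le x ((-(α * (d₁ * s))) • u) y)).1
  have hN := hf.gradY_le x (x + (-(α * (d₁ * s))) • u) y y
  have hn : ‖(-(α * (d₁ * s))) • u‖ ^ 2 = (α * (d₁ * s)) ^ 2 := by
    rw [norm_smul, hu, mul_one, Real.norm_eq_abs, sq_abs, neg_sq]
  rw [sub_self, norm_zero, add_zero, sub_add_cancel_left, norm_neg] at hN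
  rw [hn, real_inner_smul_right] at h hΦ
  set z := x + (-(α * (d₁ * s))) • u
  have hN2 : ‖gradY f x y‖ ^ 2 ≤ 2 * ‖gradY f z y‖ ^ 2 + 2 * l ^ 2 * (α * (d₁ * s)) ^ 2 := by
    have h3 : ‖gradY f x y‖ ≤ ‖gradY f z y‖ + l * ‖(-(α * (d₁ * s))) • u‖ := by
      have := norm_le_norm_add_norm_sub (gradY f z y) (gradY f x y)
      rw [norm_sub_rev] at this
      linarith
    calc _ ≤ (‖gradY f z y‖ + l * ‖(-(α * (d₁ * s))) • u‖) ^ 2 := by gcongr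
      _ ≤ 2 * (‖gradY f z y‖ ^ 2 + (l * ‖(-(α * (d₁ * s))) • u‖) ^ 2) := add_sq_le
      _ = _ := by rw [mul_pow, hn]; ring
  rw [inner_sub_left]
  rw [show inner ℝ (gradX f x y) u = inner ℝ (gradient (primalFun f) x) u +
    inner ℝ (gradX f x y - gradient (primalFun f) x) u by rw [inner_sub_left]; ring] at h hr ⊢
  set A := inner ℝ (gradient (primalFun f) x) u
  set D := inner ℝ (gradX f x y - gradient (primalFun f) x) u
  have hd' : (0 : ℝ) < d₁ := by positivity
  -- Moving ∇_y f back to x costs a term quadratic in the step; β l ≤ 1/4 turns it into the extra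
  -- l/4 in the factor 5/4 l.
  have h5 : β / 2 * (l ^ 2 * (α * (d₁ * s)) ^ 2) ≤ l / 8 * (α * (d₁ * s)) ^ 2 := by
    calc _ = β * l * (l / 2 * (α * (d₁ * s)) ^ 2) := by ring
      _ ≤ 1 / 4 * (l / 2 * (α * (d₁ * s)) ^ 2) := by gcongr
      _ = _ := by ring
  have h4 : β / 4 * ‖gradY f x y‖ ^ 2 ≤
      β / 4 * (2 * ‖gradY f z y‖ ^ 2 + 2 * l ^ 2 * (α * (d₁ * s)) ^ 2) := by gcongr
  have h6 : (3 * (l + l ^ 2 / μ) + 5 / 4 * l) / 2 * (α * (d₁ * s)) ^ 2 ≤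
      α * d₁ * (3 / 10 * s ^ 2) := by
    calc _ = α * d₁ * (α * d₁ * (3 * (l + l ^ 2 / μ) + 5 / 4 * l) * (s ^ 2 / 2)) := by ring
      _ ≤ α * d₁ * (3 / 5 * (s ^ 2 / 2)) := by gcongr
      _ = _ := by ring
  have h7 : α * d₁ * (s * (D - 2 * A) + 3 / 10 * s ^ 2) ≤
      α * d₁ * (23 / 10 * D ^ 2 - A ^ 2 + 13 / 25 * (l ^ 2 * m ^ 2)) := by
    refine mul_le_mul_of_nonneg_left ?_ (by positivity)
    obtain ⟨r, rfl⟩ : ∃ r, s = A + D + r := ⟨s - (A + D), by ring⟩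
    rw [add_sub_cancel_left] at hr
    -- The three squares enter with weights 1/5, 1/2 and 4/5, after r² ≤ l²m²/4.
    nlinarith [sq_nonneg (A + D), sq_nonneg (A + 7 / 5 * r), sq_nonneg (D - r)]
  rw [show A + D - A = D by ring]
  nlinarith

theorem continuous_zoGradX (hf : HasLipschitzGradients f l) (m : ℝ) :
    Continuous fun p : (EuclideanSpace ℝ (Fin d₁) × EuclideanSpace ℝ (Fin d₂)) ×
      EuclideanSpace ℝ (Fin d₁) => zoGradX f m p.1.1 p.1.2 p.2 := by
  have hc := hf.differentiable.continuous
  unfold zoGradX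
  refine Continuous.smul (f := fun p => (_ : ℝ)) ?_ continuous_snd
  refine Continuous.div_const (Continuous.sub ?_ ?_) _
  · exact hc.comp (show Continuous fun p : (EuclideanSpace ℝ (Fin d₁) × EuclideanSpace ℝ (Fin d₂)) ×
      EuclideanSpace ℝ (Fin d₁) => (p.1.1 + m • p.2, p.1.2) by fun_prop)
  · exact hc.comp continuous_fst

theorem continuous_zoGradY (hf : HasLipschitzGradients f l) (m : ℝ) :
    Continuous fun p : (EuclideanSpace ℝ (Fin d₁) × EuclideanSpace ℝ (Fin d₂)) ×
      EuclideanSpace ℝ (Fin d₂) => zoGradY f m p.1.1 p.1.2 p.2 := by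
  have hc := hf.differentiable.continuous
  unfold zoGradY
  refine Continuous.smul (f := fun p => (_ : ℝ)) ?_ continuous_snd
  refine Continuous.div_const (Continuous.sub ?_ ?_) _
  · exact hc.comp (show Continuous fun p : (EuclideanSpace ℝ (Fin d₁) × EuclideanSpace ℝ (Fin d₂)) ×
      EuclideanSpace ℝ (Fin d₂) => (p.1.1, p.1.2 + m • p.2) by fun_prop)
  · exact hc.comp continuous_fst

theorem HasLipschitzGradients.integral_ascent_step_le (hf : HasLipschitzGradients f l) {β m : ℝ}
    (hβ : 0 < β) (hd : 0 < d₂) (hβl : l * β * d₂ ≤ 1 / 4) (hm : 0 < m)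
    (x : EuclideanSpace ℝ (Fin d₁)) (y : EuclideanSpace ℝ (Fin d₂)) (c : ℝ) :
    ∫ v, (c - f x (y + β • zoGradY f m x y v)) ∂(uniformSphere d₂) ≤
      c - f x y - β / 2 * ‖gradY f x y‖ ^ 2 + 5 / 16 * (β * d₂ * (l ^ 2 * m ^ 2)) := by
  have := isProbabilityMeasure_uniformSphere hd
  have hd' : (d₂ : ℝ) ≠ 0 := by positivity
  have hc1 : Continuous fun v => zoGradY f m x y v :=
    (continuous_zoGradY hf m).comp (Continuous.prodMk_right (x, y))
  have hc2 : Continuous fun v => c - f x (y + β • zoGradY f m x y v) :=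
    continuous_const.sub
      ((hf.differentiable_right x).continuous.comp (continuous_const.add (hc1.const_smul β)))
  have hi := integrable_inner_sq_uniformSphere hd (gradY f x y)
  calc _ ≤ ∫ v, (c - f x y + 5 / 16 * (β * d₂ * (l ^ 2 * m ^ 2)) -
          β * d₂ / 2 * inner ℝ (gradY f x y) v ^ 2) ∂(uniformSphere d₂) := by
        refine integral_mono_ae (integrable_uniformSphere_of_continuous hd hc2)
          ((integrable_const _).sub (hi.const_mul _)) ?_
        filter_upwards [ae_norm_eq_one_uniformSphere d₂] with v hv
        linarith [hf.ascent_step_ge hβ hd hβl hm x y v hv]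
    _ = _ := by
        rw [integral_sub (integrable_const _) (hi.const_mul _), integral_const_mul,
          integral_inner_sq_uniformSphere hd, integral_const, probReal_univ, one_smul]
        field_simp
        ring

theorem HasLipschitzGradients.integral_descent_step_le (hf : HasLipschitzGradients f l)
    (hPL : IsPLInY f μ) (hl : 0 < l) (hμ : 0 < μ) {α β m : ℝ} (hα : 0 < α) (hβ : 0 < β)
    (hd : 0 < d₁) (hβl : β * l ≤ 1 / 4)
    (hαl : α * d₁ * (3 * (l + l ^ 2 / μ) + 5 / 4 * l) ≤ 3 / 5)
    (hαβ : α * (32 * (l / μ) ^ 2) ≤ β) (hm : 0 < m)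
    (x : EuclideanSpace ℝ (Fin d₁)) (y : EuclideanSpace ℝ (Fin d₂)) :
    ∫ u, (3 * primalFun f (x - α • zoGradX f m x y u) - f (x - α • zoGradX f m x y u) y -
        β / 2 * ‖gradY f (x - α • zoGradX f m x y u) y‖ ^ 2) ∂(uniformSphere d₁) ≤
      3 * primalFun f x - f x y - α * ‖gradient (primalFun f) x‖ ^ 2 +
        13 / 25 * (α * d₁ * (l ^ 2 * m ^ 2)) := by
  have := isProbabilityMeasure_uniformSphere hd
  have hd' : (d₁ : ℝ) ≠ 0 := by positivity
  have hc1 : Continuous fun u => x - α • zoGradX f m x y u :=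
    continuous_const.sub (((continuous_zoGradX hf m).comp
      (Continuous.prodMk_right (x, y))).const_smul α)
  have hc2 : Continuous fun u => 3 * primalFun f (x - α • zoGradX f m x y u) -
      f (x - α • zoGradX f m x y u) y -
        β / 2 * ‖gradY f (x - α • zoGradX f m x y u) y‖ ^ 2 :=
    (((differentiable_primalFun hf hPL hμ).continuous.comp hc1).const_mul 3 |>.sub
      ((hf.differentiable_left y).continuous.comp hc1)).sub
      (((hf.continuous_gradY.comp (hc1.prodMk continuous_const)).norm.pow 2).const_mul _)
  have hi := integrable_inner_sq_uniformSphere hd (gradX f x y - gradient (primalFun f) x)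
  have hj := integrable_inner_sq_uniformSphere hd (gradient (primalFun f) x)
  have hij : Integrable (fun u =>
      23 / 10 * (α * d₁) * inner ℝ (gradX f x y - gradient (primalFun f) x) u ^ 2 -
        α * d₁ * inner ℝ (gradient (primalFun f) x) u ^ 2) (uniformSphere d₁) :=
    (hi.const_mul _).sub (hj.const_mul _)
  have hδ := sq_norm_gradX_sub_gradient_primalFun_le hf hPL hl hμ x y
  -- Here α ≤ β/(32κ²) is used: 23/10 · 3/32 = 69/320 < 1/4.
  have hδ' : 23 / 10 * (α * ‖gradX f x y - gradient (primalFun f) x‖ ^ 2) ≤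
      β / 4 * ‖gradY f x y‖ ^ 2 := by
    calc _ ≤ 23 / 10 * (α * (3 * (l / μ) ^ 2 * ‖gradY f x y‖ ^ 2)) := by gcongr
      _ = 69 / 320 * (α * (32 * (l / μ) ^ 2)) * ‖gradY f x y‖ ^ 2 := by ring
      _ ≤ 69 / 320 * β * ‖gradY f x y‖ ^ 2 := by gcongr
      _ ≤ _ := by gcongr; linarith
  calc _ ≤ ∫ u, (3 * primalFun f x - f x y - β / 4 * ‖gradY f x y‖ ^ 2 +
          13 / 25 * (α * d₁ * (l ^ 2 * m ^ 2)) +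
          (23 / 10 * (α * d₁) * inner ℝ (gradX f x y - gradient (primalFun f) x) u ^ 2 -
          α * d₁ * inner ℝ (gradient (primalFun f) x) u ^ 2)) ∂(uniformSphere d₁) := by
        refine integral_mono_ae (integrable_uniformSphere_of_continuous hd hc2)
          ((integrable_const _).add hij) ?_
        filter_upwards [ae_norm_eq_one_uniformSphere d₁] with u hu
        linarith [hf.descent_step_le hPL hl hμ hα hβ hd hβl hαl hm x y u hu]
    _ = 3 * primalFun f x - f x y - β / 4 * ‖gradY f x y‖ ^ 2 +
          13 / 25 * (α * d₁ * (l ^ 2 * m ^ 2)) +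
          (23 / 10 * (α * ‖gradX f x y - gradient (primalFun f) x‖ ^ 2) -
            α * ‖gradient (primalFun f) x‖ ^ 2) := by
        rw [integral_add (integrable_const _) hij,
          integral_sub (hi.const_mul _) (hj.const_mul _), integral_const_mul, integral_const_mul,
          integral_inner_sq_uniformSphere hd, integral_inner_sq_uniformSphere hd, integral_const,
          probReal_univ, one_smul]
        field_simp
    _ ≤ _ := by linarith

end Steps

/-! ### Independence of the current direction from the past -/

theorem IndepFun.prodMk_right_of_prodMk_left {Ω A B C : Type*} [MeasurableSpace Ω]
    [MeasurableSpace A] [MeasurableSpace B] [MeasurableSpace C] {P : Measure Ω}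
    [IsProbabilityMeasure P] {X : Ω → A} {Y : Ω → B} {W : Ω → C} (hX : Measurable X)
    (hY : Measurable Y) (hW : Measurable W) (hXY : IndepFun X Y P)
    (h : IndepFun (fun ω => (X ω, Y ω)) W P) : IndepFun X (fun ω => (Y ω, W ω)) P := by
  have hYW : IndepFun Y W P := h.comp measurable_snd measurable_id
  have := Measure.isProbabilityMeasure_map (μ := P) hX.aemeasurable
  have := Measure.isProbabilityMeasure_map (μ := P) hY.aemeasurable
  have := Measure.isProbabilityMeasure_map (μ := P) hW.aemeasurable
  rw [indepFun_iff_map_prod_eq_prod_map_map hX.aemeasurable hY.aemeasurable] at hXY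
  rw [indepFun_iff_map_prod_eq_prod_map_map hY.aemeasurable hW.aemeasurable] at hYW
  rw [indepFun_iff_map_prod_eq_prod_map_map (hX.prodMk hY).aemeasurable hW.aemeasurable, hXY] at h
  rw [indepFun_iff_map_prod_eq_prod_map_map hX.aemeasurable (hY.prodMk hW).aemeasurable, hYW,
    ← Measure.prodAssoc_prod, ← h, Measure.map_map (by fun_prop) (by fun_prop)]
  rfl

/-- The past is encoded as a full sequence with zeros from time t on, so that `zoAGDA` can be run on
it; by `zoAGDA_congr` the padding does not affect the iterate at time t. -/
theorem iIndepFun.indepFun_truncate {Ω A : Type*} [MeasurableSpace Ω] [MeasurableSpace A] [Zero A]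
    {P : Measure Ω} {u : ℕ → Ω → A} (hu : iIndepFun u P) (hu_meas : ∀ t, Measurable (u t))
    (t : ℕ) : IndepFun (u t) (fun ω s => if s < t then u s ω else 0) P := by
  have h := hu.indepFun_finset {t} (Finset.range t) (by simp) hu_meas
  have hm : Measurable fun (w : Finset.range t → A) (s : ℕ) =>
      if hs : s < t then w ⟨s, Finset.mem_range.2 hs⟩ else 0 := by
    refine measurable_pi_lambda _ fun s => ?_
    by_cases hs : s < t
    · simpa [hs] using measurable_pi_apply _
    · simp [hs]
  exact h.comp (measurable_pi_apply ⟨t, Finset.mem_singleton_self t⟩) hm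

/-- Fubini on the product law replaces conditioning on the past Z. -/
theorem IndepFun.integral_le_of_forall_integral_le {Ω A B : Type*} [MeasurableSpace Ω]
    [MeasurableSpace A] [MeasurableSpace B] {P : Measure Ω} [IsProbabilityMeasure P] {Z : Ω → A}
    {U : Ω → B} (hZ : Measurable Z) (hU : Measurable U) (h : IndepFun U Z P) {F : A × B → ℝ}
    (hF : Measurable F) (hFi : Integrable (fun ω => F (Z ω, U ω)) P) {G : A → ℝ}
    (hG : Measurable G) (hGi : Integrable (fun ω => G (Z ω)) P)
    (hFG : ∀ z, ∫ w, F (z, w) ∂(P.map U) ≤ G z) :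
    ∫ ω, F (Z ω, U ω) ∂P ≤ ∫ ω, G (Z ω) ∂P := by
  have := Measure.isProbabilityMeasure_map (μ := P) hZ.aemeasurable
  have := Measure.isProbabilityMeasure_map (μ := P) hU.aemeasurable
  have hmap := (indepFun_iff_map_prod_eq_prod_map_map hZ.aemeasurable hU.aemeasurable).1 h.symm
  have hFi' : Integrable F ((P.map Z).prod (P.map U)) := by
    rw [← hmap]
    exact (integrable_map_measure hF.aestronglyMeasurable (hZ.prodMk hU).aemeasurable).2 hFi
  rw [← integral_map (hZ.prodMk hU).aemeasurable hF.aestronglyMeasurable, hmap,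
    integral_prod _ hFi', ← integral_map hZ.aemeasurable hG.aestronglyMeasurable]
  exact integral_mono hFi'.integral_prod_left
    ((integrable_map_measure hG.aestronglyMeasurable hZ.aemeasurable).2 hGi) hFG

/-! ### Iterates as functions of the directions -/

section Iterates

variable {d₁ d₂ : ℕ} {f : EuclideanSpace ℝ (Fin d₁) → EuclideanSpace ℝ (Fin d₂) → ℝ} {l : ℝ}

theorem continuous_zoAGDA (hf : HasLipschitzGradients f l) (α β μ₁ μ₂ : ℝ)
    (x₀ : EuclideanSpace ℝ (Fin d₁)) (y₀ : EuclideanSpace ℝ (Fin d₂)) (t : ℕ) :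
    Continuous fun w : (ℕ → EuclideanSpace ℝ (Fin d₁)) × (ℕ → EuclideanSpace ℝ (Fin d₂)) =>
      zoAGDA f α β μ₁ μ₂ x₀ y₀ w.1 w.2 t := by
  induction t with
  | zero => exact continuous_const
  | succ t ih =>
    have hx := ih.fst.sub (((continuous_zoGradX hf μ₁).comp
      (ih.prodMk ((continuous_apply t).comp continuous_fst))).const_smul α)
    exact hx.prodMk (ih.snd.add (((continuous_zoGradY hf μ₂).comp
      ((hx.prodMk ih.snd).prodMk ((continuous_apply t).comp continuous_snd))).const_smul β))

theorem zoAGDA_congr {α β μ₁ μ₂ : ℝ} {x₀ : EuclideanSpace ℝ (Fin d₁)}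
    {y₀ : EuclideanSpace ℝ (Fin d₂)} {u u' : ℕ → EuclideanSpace ℝ (Fin d₁)}
    {v v' : ℕ → EuclideanSpace ℝ (Fin d₂)} {t : ℕ} (hu : ∀ s < t, u s = u' s)
    (hv : ∀ s < t, v s = v' s) :
    zoAGDA f α β μ₁ μ₂ x₀ y₀ u v t = zoAGDA f α β μ₁ μ₂ x₀ y₀ u' v' t := by
  induction t with
  | zero => rfl
  | succ t ih =>
    simp only [zoAGDA]
    rw [ih (fun s hs => hu s (hs.trans t.lt_succ_self)) fun s hs => hv s (hs.trans t.lt_succ_self),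
      hu t t.lt_succ_self, hv t t.lt_succ_self]

end Iterates

/-! ### Expected decrease of the potential -/

section Expectation

variable {d₁ d₂ : ℕ} {f : EuclideanSpace ℝ (Fin d₁) → EuclideanSpace ℝ (Fin d₂) → ℝ} {l μ : ℝ}
  {Ω : Type*} [MeasurableSpace Ω] {P : Measure Ω} [IsProbabilityMeasure P]
  {u : ℕ → Ω → EuclideanSpace ℝ (Fin d₁)} {v : ℕ → Ω → EuclideanSpace ℝ (Fin d₂)}

theorem measurable_norm_gradient_primalFun :
    Measurable fun x : EuclideanSpace ℝ (Fin d₁) => ‖gradient (primalFun f) x‖ := by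
  simp only [gradient, LinearIsometryEquiv.norm_map]
  exact (measurable_fderiv ℝ _).norm

/-- Supplies a continuous majorant, so that measurability of ∇Φ suffices for integrability along the
iterates. -/
theorem norm_gradient_primalFun_le (hf : HasLipschitzGradients f l) (hPL : IsPLInY f μ)
    (hl : 0 < l) (hμ : 0 < μ) (x : EuclideanSpace ℝ (Fin d₁)) (y : EuclideanSpace ℝ (Fin d₂)) :
    ‖gradient (primalFun f) x‖ ≤
      ‖gradX f x y‖ + (1 + 3 * (l / μ) ^ 2 * ‖gradY f x y‖ ^ 2) := by
  have h := sq_norm_gradX_sub_gradient_primalFun_le hf hPL hl hμ x y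
  have h1 := norm_le_norm_add_norm_sub (gradX f x y) (gradient (primalFun f) x)
  nlinarith [sq_nonneg (‖gradX f x y - gradient (primalFun f) x‖ - 1)]

/-- Almost surely the directions lie in a product of spheres, compact by Tychonoff, on which F is
bounded. -/
theorem integrable_of_continuous_directions (hu_meas : ∀ t, Measurable (u t))
    (hv_meas : ∀ t, Measurable (v t)) (hu_law : ∀ t, P.map (u t) = uniformSphere d₁)
    (hv_law : ∀ t, P.map (v t) = uniformSphere d₂)
    {F : (ℕ → EuclideanSpace ℝ (Fin d₁)) × (ℕ → EuclideanSpace ℝ (Fin d₂)) → ℝ}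
    (hF : Continuous F) : Integrable (fun ω => F (fun s => u s ω, fun s => v s ω)) P := by
  have hK : IsCompact
      ((Set.univ.pi fun _ : ℕ => Metric.sphere (0 : EuclideanSpace ℝ (Fin d₁)) 1) ×ˢ
        (Set.univ.pi fun _ : ℕ => Metric.sphere (0 : EuclideanSpace ℝ (Fin d₂)) 1)) :=
    (isCompact_univ_pi fun _ => isCompact_sphere _ _).prod
      (isCompact_univ_pi fun _ => isCompact_sphere _ _)
  refine integrable_of_continuous_of_ae_mem_isCompact
    (Z := fun ω => (fun s => u s ω, fun s => v s ω))
    ((measurable_pi_lambda _ hu_meas).prodMk (measurable_pi_lambda _ hv_meas)) hK ?_ hF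
  have hu : ∀ᵐ ω ∂P, ∀ s, ‖u s ω‖ = 1 := ae_all_iff.2 fun s =>
    ae_of_ae_map (hu_meas s).aemeasurable (hu_law s ▸ ae_norm_eq_one_uniformSphere d₁)
  have hv : ∀ᵐ ω ∂P, ∀ s, ‖v s ω‖ = 1 := ae_all_iff.2 fun s =>
    ae_of_ae_map (hv_meas s).aemeasurable (hv_law s ▸ ae_norm_eq_one_uniformSphere d₂)
  filter_upwards [hu, hv] with ω h1 h2
  simp [Set.mem_prod, h1, h2]

theorem integrable_norm_gradient_primalFun_zoAGDA (hf : HasLipschitzGradients f l)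
    (hPL : IsPLInY f μ) (hl : 0 < l) (hμ : 0 < μ) {α β μ₁ μ₂ : ℝ}
    (x₀ : EuclideanSpace ℝ (Fin d₁)) (y₀ : EuclideanSpace ℝ (Fin d₂))
    (hu_meas : ∀ t, Measurable (u t))
    (hv_meas : ∀ t, Measurable (v t)) (hu_law : ∀ t, P.map (u t) = uniformSphere d₁)
    (hv_law : ∀ t, P.map (v t) = uniformSphere d₂) (t : ℕ) :
    Integrable (fun ω => ‖gradient (primalFun f)
      (zoAGDA f α β μ₁ μ₂ x₀ y₀ (fun s => u s ω) (fun s => v s ω) t).1‖) P := by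
  have hc := continuous_zoAGDA hf α β μ₁ μ₂ x₀ y₀ t
  have hS : Measurable fun ω => (fun s => u s ω, fun s => v s ω) :=
    (measurable_pi_lambda _ hu_meas).prodMk (measurable_pi_lambda _ hv_meas)
  refine Integrable.mono' (integrable_of_continuous_directions hu_meas hv_meas hu_law hv_law
    (((hf.continuous_gradX.comp hc).norm).add
      ((((hf.continuous_gradY.comp hc).norm.pow 2).const_mul (3 * (l / μ) ^ 2)).const_add 1)))
    ((measurable_norm_gradient_primalFun.comp
      (hc.measurable.comp hS).fst).aestronglyMeasurable) (Filter.Eventually.of_forall fun ω => ?_)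
  rw [norm_norm]
  exact norm_gradient_primalFun_le hf hPL hl hμ _ _

theorem integral_zoAGDA_succ_le (hd₁ : 0 < d₁) (hd₂ : 0 < d₂) (hf : HasLipschitzGradients f l)
    (hPL : IsPLInY f μ) (hl : 0 < l) (hμ : 0 < μ) {α β ε μ₁ μ₂ : ℝ} (hα : 0 < α) (hβ : 0 < β)
    (hβl : l * β * d₂ ≤ 1 / 4) (hβl' : β * l ≤ 1 / 4)
    (hαl : α * d₁ * (3 * (l + l ^ 2 / μ) + 5 / 4 * l) ≤ 3 / 5)
    (hαβ : α * (32 * (l / μ) ^ 2) ≤ β) (hμ₁ : 0 < μ₁) (hμ₂ : 0 < μ₂)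
    (x₀ : EuclideanSpace ℝ (Fin d₁)) (y₀ : EuclideanSpace ℝ (Fin d₂))
    (hu_meas : ∀ t, Measurable (u t)) (hv_meas : ∀ t, Measurable (v t))
    (hu_law : ∀ t, P.map (u t) = uniformSphere d₁) (hv_law : ∀ t, P.map (v t) = uniformSphere d₂)
    (hu_indep : iIndepFun u P) (hv_indep : iIndepFun v P)
    (huv_indep : IndepFun (fun ω t => u t ω) (fun ω t => v t ω) P)
    {Z : ℕ → Ω → EuclideanSpace ℝ (Fin d₁) × EuclideanSpace ℝ (Fin d₂)}
    (hZ : ∀ t ω, Z t ω = zoAGDA f α β μ₁ μ₂ x₀ y₀ (fun s => u s ω) (fun s => v s ω) t) (t : ℕ) :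
    ∫ ω, (3 * primalFun f (Z (t + 1) ω).1 - f (Z (t + 1) ω).1 (Z (t + 1) ω).2) ∂P ≤
      ∫ ω, (3 * primalFun f (Z t ω).1 - f (Z t ω).1 (Z t ω).2) ∂P -
        2 * α * ε * ∫ ω, ‖gradient (primalFun f) (Z t ω).1‖ ∂P + α * ε ^ 2 +
        (13 / 25 * (α * d₁ * (l ^ 2 * μ₁ ^ 2)) + 5 / 16 * (β * d₂ * (l ^ 2 * μ₂ ^ 2))) := by
  obtain ⟨Φ, hΦ⟩ : ∃ Φ, Φ = primalFun f := ⟨_, rfl⟩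
  have hΦc : Continuous Φ := hΦ ▸ (differentiable_primalFun hf hPL hμ).continuous
  have hfc : Continuous fun p : _ × _ => f p.1 p.2 := hf.differentiable.continuous
  set S : Ω → (ℕ → EuclideanSpace ℝ (Fin d₁)) × (ℕ → EuclideanSpace ℝ (Fin d₂)) :=
    fun ω => (fun s => u s ω, fun s => v s ω)
  have hum : Measurable fun ω s => u s ω := measurable_pi_lambda _ hu_meas
  have hvm : Measurable fun ω s => v s ω := measurable_pi_lambda _ hv_meas
  have hS : Measurable S := hum.prodMk hvm
  have hc := continuous_zoAGDA hf α β μ₁ μ₂ x₀ y₀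
  have hZm : ∀ t, Measurable (Z t) := fun t => by
    rw [funext (hZ t)]
    exact (hc t).measurable.comp hS
  have hint_S : ∀ {F : _ → ℝ}, Continuous F → Integrable (fun ω => F (S ω)) P := fun hF =>
    integrable_of_continuous_directions hu_meas hv_meas hu_law hv_law hF
  -- the point at which the ascent step is taken
  let X : Ω → EuclideanSpace ℝ (Fin d₁) := fun ω => (Z (t + 1) ω).1
  have hX : ∀ ω, X ω = (Z t ω).1 - α • zoGradX f μ₁ (Z t ω).1 (Z t ω).2 (u t ω) := fun ω => by
    simp only [X, hZ]
    rfl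
  have hY : ∀ ω, (Z (t + 1) ω).2 =
      (Z t ω).2 + β • zoGradY f μ₂ (X ω) (Z t ω).2 (v t ω) := fun ω => by
    simp only [X, hZ]
    rfl
  have hXm : Measurable X := (hZm (t + 1)).fst
  set c₁ := 13 / 25 * (α * d₁ * (l ^ 2 * μ₁ ^ 2))
  set c₂ := 5 / 16 * (β * d₂ * (l ^ 2 * μ₂ ^ 2))
  let W : EuclideanSpace ℝ (Fin d₁) × EuclideanSpace ℝ (Fin d₂) → ℝ :=
    fun p => 3 * Φ p.1 - f p.1 p.2 - β / 2 * ‖gradY f p.1 p.2‖ ^ 2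
  have hWc : Continuous W := (((hΦc.comp continuous_fst).const_mul 3).sub hfc).sub
    ((hf.continuous_gradY.norm.pow 2).const_mul _)
  have hVc : Continuous fun p : _ × _ => 3 * Φ p.1 - f p.1 p.2 :=
    ((hΦc.comp continuous_fst).const_mul 3).sub hfc
  have hWi : Integrable (fun ω => W (X ω, (Z t ω).2)) P := by
    simp only [X, hZ]
    exact hint_S (F := fun w => W ((zoAGDA f α β μ₁ μ₂ x₀ y₀ w.1 w.2 (t + 1)).1,
      (zoAGDA f α β μ₁ μ₂ x₀ y₀ w.1 w.2 t).2)) (hWc.comp ((hc (t + 1)).fst.prodMk (hc t).snd))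
  have hVi : ∀ t, Integrable (fun ω => 3 * Φ (Z t ω).1 - f (Z t ω).1 (Z t ω).2) P := fun t => by
    simp only [hZ]
    exact hint_S (hVc.comp (hc t))
  have hgi : Integrable (fun ω => ‖gradient Φ (Z t ω).1‖) P := by
    simp only [hZ, hΦ]
    exact integrable_norm_gradient_primalFun_zoAGDA hf hPL hl hμ x₀ y₀ hu_meas hv_meas hu_law
      hv_law t
  have hVgi : Integrable (fun ω => 3 * Φ (Z t ω).1 - f (Z t ω).1 (Z t ω).2 -
      2 * α * ε * ‖gradient Φ (Z t ω).1‖) P := (hVi t).sub (hgi.const_mul _)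
  rw [← hΦ]
  have ascent : ∫ ω, (3 * Φ (Z (t + 1) ω).1 - f (Z (t + 1) ω).1 (Z (t + 1) ω).2) ∂P ≤
      ∫ ω, (W (X ω, (Z t ω).2) + c₂) ∂P := by
    -- The ascent point already involves u_t, so v_t is compared with its own past together with the
    -- whole sequence u.
    have hind : IndepFun (v t) (fun ω => (X ω, (Z t ω).2)) P := by
      have htm := measurable_pi_lambda (fun ω s => if s < t then v s ω else 0) fun s => by
        by_cases hs : s < t
        · simpa [hs] using hv_meas s
        · simp [hs]
      have h1 := IndepFun.prodMk_right_of_prodMk_left (hv_meas t) htm hum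
        (iIndepFun.indepFun_truncate hv_indep hv_meas t)
        (huv_indep.symm.comp (φ := fun w : ℕ → EuclideanSpace ℝ (Fin d₂) =>
          (w t, fun s => if s < t then w s else 0))
          ((measurable_pi_apply t).prodMk (measurable_pi_lambda _ fun s => by
            by_cases hs : s < t
            · simpa [hs] using measurable_pi_apply s
            · simp [hs])) measurable_id)
      have h2 : Continuous fun w : (ℕ → EuclideanSpace ℝ (Fin d₂)) ×
          (ℕ → EuclideanSpace ℝ (Fin d₁)) =>
          ((zoAGDA f α β μ₁ μ₂ x₀ y₀ w.2 w.1 t).1 - α • zoGradX f μ₁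
            (zoAGDA f α β μ₁ μ₂ x₀ y₀ w.2 w.1 t).1 (zoAGDA f α β μ₁ μ₂ x₀ y₀ w.2 w.1 t).2 (w.2 t),
            (zoAGDA f α β μ₁ μ₂ x₀ y₀ w.2 w.1 t).2) := by
        have h3 := (hc t).comp continuous_swap
        exact (h3.fst.sub (((continuous_zoGradX hf μ₁).comp
          (h3.prodMk ((continuous_apply t).comp continuous_snd))).const_smul α)).prodMk h3.snd
      refine IndepFun.congr (h1.comp measurable_id h2.measurable) Filter.EventuallyEq.rfl
        (Filter.Eventually.of_forall fun ω => ?_)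
      simp only [Function.comp_apply, hX, hZ]
      rw [zoAGDA_congr (v := fun s => if s < t then v s ω else 0) (v' := fun s => v s ω)
        (fun _ _ => rfl) fun s hs => by simp [hs]]
    have hFc : Continuous fun q : (EuclideanSpace ℝ (Fin d₁) × EuclideanSpace ℝ (Fin d₂)) ×
        EuclideanSpace ℝ (Fin d₂) =>
        3 * Φ q.1.1 - f q.1.1 (q.1.2 + β • zoGradY f μ₂ q.1.1 q.1.2 q.2) :=
      hVc.comp (continuous_fst.fst.prodMk
        (continuous_fst.snd.add ((continuous_zoGradY hf μ₂).const_smul β)))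
    have h := IndepFun.integral_le_of_forall_integral_le (hXm.prodMk (hZm t).snd) (hv_meas t) hind
      hFc.measurable (by simpa only [hY] using hVi (t + 1)) (hWc.add_const c₂).measurable
      (hWi.add (integrable_const c₂)) fun z => by
        rw [hv_law]
        exact hf.integral_ascent_step_le hβ hd₂ hβl hμ₂ z.1 z.2 (3 * Φ z.1)
    simpa only [hY] using h
  have descent : ∫ ω, W (X ω, (Z t ω).2) ∂P ≤
      ∫ ω, (3 * Φ (Z t ω).1 - f (Z t ω).1 (Z t ω).2 - 2 * α * ε * ‖gradient Φ (Z t ω).1‖ +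
        (α * ε ^ 2 + c₁)) ∂P := by
    have hind : IndepFun (u t) (Z t) P := by
      have htm := measurable_pi_lambda (fun ω s => if s < t then u s ω else 0) fun s => by
        by_cases hs : s < t
        · simpa [hs] using hu_meas s
        · simp [hs]
      have h1 := IndepFun.prodMk_right_of_prodMk_left (hu_meas t) htm hvm
        (iIndepFun.indepFun_truncate hu_indep hu_meas t)
        (huv_indep.comp (φ := fun w : ℕ → EuclideanSpace ℝ (Fin d₁) =>
          (w t, fun s => if s < t then w s else 0))
          ((measurable_pi_apply t).prodMk (measurable_pi_lambda _ fun s => by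
            by_cases hs : s < t
            · simpa [hs] using measurable_pi_apply s
            · simp [hs])) measurable_id)
      refine IndepFun.congr (h1.comp measurable_id (hc t).measurable) Filter.EventuallyEq.rfl
        (Filter.Eventually.of_forall fun ω => ?_)
      simp only [Function.comp_apply, hZ]
      exact zoAGDA_congr (fun s hs => by simp [hs]) fun _ _ => rfl
    have hFc : Continuous fun q : (EuclideanSpace ℝ (Fin d₁) × EuclideanSpace ℝ (Fin d₂)) ×
        EuclideanSpace ℝ (Fin d₁) =>
        W (q.1.1 - α • zoGradX f μ₁ q.1.1 q.1.2 q.2, q.1.2) :=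
      hWc.comp ((continuous_fst.fst.sub ((continuous_zoGradX hf μ₁).const_smul α)).prodMk
        continuous_fst.snd)
    have h := IndepFun.integral_le_of_forall_integral_le (hZm t) (hu_meas t) hind
      hFc.measurable (by simpa only [hX] using hWi)
      (G := fun p => 3 * Φ p.1 - f p.1 p.2 - 2 * α * ε * ‖gradient Φ p.1‖ + (α * ε ^ 2 + c₁))
      ((hVc.measurable.sub (((hΦ ▸ measurable_norm_gradient_primalFun :
        Measurable fun x => ‖gradient Φ x‖).comp measurable_fst).const_mul _)).add_const _)
      (hVgi.add (integrable_const _)) fun z => by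
        rw [hu_law]
        have hstep := hf.integral_descent_step_le hPL hl hμ hα hβ hd₁ hβl' hαl hαβ hμ₁ z.1 z.2
        rw [← hΦ] at hstep
        refine hstep.trans ?_
        -- Linearizing the square, ‖∇Φ‖² ≥ 2ε‖∇Φ‖ - ε², leaves only the first moment of ‖∇Φ‖ to
        -- integrate.
        have hsq := mul_nonneg hα.le (sq_nonneg (‖gradient Φ z.1‖ - ε))
        simp only [c₁]
        linarith
    simpa only [hX] using h
  rw [integral_add hWi (integrable_const _), integral_const, probReal_univ, one_smul] at ascent
  rw [integral_add hVgi (integrable_const _),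
    integral_sub (hVi t) (hgi.const_mul _), integral_const_mul, integral_const, probReal_univ,
    one_smul] at descent
  linarith

end Expectation

/-! ### Hitting time and conclusion -/

theorem exists_isLeast_and_le_of_decrease {a V : ℕ → ℝ} {ε δ m : ℝ} (hδ : 0 < δ)
    (hV : ∀ t, m ≤ V t) (h : ∀ t, ε < a t → V (t + 1) ≤ V t - δ) :
    ∃ T : ℕ, IsLeast {t | a t ≤ ε} T ∧ (T : ℝ) ≤ (V 0 - m) / δ := by
  have key : ∀ N : ℕ, (∀ t < N, ε < a t) → (N : ℝ) ≤ (V 0 - m) / δ := by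
    intro N hN
    have h1 : ∀ n ≤ N, V n ≤ V 0 - n * δ := by
      intro n
      induction n with
      | zero => simp
      | succ n ih =>
        intro hn
        have := h n (hN n hn)
        have := ih (by omega)
        push_cast
        linarith
    rw [le_div_iff₀ hδ]
    linarith [h1 N le_rfl, hV N]
  have hne : ∃ t, a t ≤ ε := by
    by_contra! hcon
    obtain ⟨N, hN⟩ := exists_nat_gt ((V 0 - m) / δ)
    exact (key N fun t _ => hcon t).not_gt hN
  classical
  exact ⟨Nat.find hne, ⟨Nat.find_spec hne, fun t ht => Nat.find_min' hne ht⟩,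
    key _ fun t ht => not_le.1 (Nat.find_min hne ht)⟩

theorem theorem1 {d₁ d₂ : ℕ} (hd₁ : 0 < d₁) (hd₂ : 0 < d₂)
    (f : EuclideanSpace ℝ (Fin d₁) → EuclideanSpace ℝ (Fin d₂) → ℝ)
    (l μ : ℝ) (hl : 0 < l) (hμ : 0 < μ)
    (hsmooth : HasLipschitzGradients f l) (hPL : IsPLInY f μ)
    (Φstar : ℝ) (hΦstar : IsLeast (Set.range (primalFun f)) Φstar)
    (L κ : ℝ) (hL : L = l + l ^ 2 / (2 * μ)) (hκ : κ = l / μ)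
    (α β ε : ℝ) (hα₀ : 0 < α) (hβ₀ : 0 < β) (hε : 0 < ε)
    (hβ : β ≤ 1 / (4 * d₂ * L))
    (hα : α ≤ min (β / (32 * κ ^ 2)) (1 / (10 * d₁ * L)))
    (θ₁ μ₁ μ₂ : ℝ)
    (hθ₁ : θ₁ = (5 * d₁ * L + 3 / (2 * α) + 3 / 2 * L + d₂ * L) * d₁ ^ 2 * L ^ 2 * α ^ 2)
    (hμ₁ : μ₁ = √α * ε / (2 * √θ₁))
    (hμ₂ : μ₂ = √α * ε / (√(3 * β) * d₂ * L))
    (x₀ : EuclideanSpace ℝ (Fin d₁)) (y₀ : EuclideanSpace ℝ (Fin d₂))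
    -- the random directions: independent, uniform on the unit spheres
    {Ω : Type*} [MeasurableSpace Ω] (P : Measure Ω) [IsProbabilityMeasure P]
    (u : ℕ → Ω → EuclideanSpace ℝ (Fin d₁)) (v : ℕ → Ω → EuclideanSpace ℝ (Fin d₂))
    (hu_meas : ∀ t, Measurable (u t)) (hv_meas : ∀ t, Measurable (v t))
    (hu_law : ∀ t, P.map (u t) = uniformSphere d₁)
    (hv_law : ∀ t, P.map (v t) = uniformSphere d₂)
    (hu_indep : iIndepFun u P) (hv_indep : iIndepFun v P)
    (huv_indep : IndepFun (fun ω t => u t ω) (fun ω t => v t ω) P)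
    (x : ℕ → Ω → EuclideanSpace ℝ (Fin d₁))
    (hx : ∀ t ω, x t ω =
      (zoAGDA f α β μ₁ μ₂ x₀ y₀ (fun s => u s ω) (fun s => v s ω) t).1) :
    Differentiable ℝ (primalFun f) ∧
    (∀ t, Integrable (fun ω => ‖gradient (primalFun f) (x t ω)‖) P) ∧
    ∃ T : ℕ, IsLeast {t : ℕ | ∫ ω, ‖gradient (primalFun f) (x t ω)‖ ∂P ≤ ε} T ∧
      (T : ℝ) ≤ 4 * (3 * primalFun f x₀ - f x₀ y₀ - 2 * Φstar) / (α * ε ^ 2) := by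
  have hd₁' : (1 : ℝ) ≤ d₁ := by exact_mod_cast hd₁
  have hd₂' : (1 : ℝ) ≤ d₂ := by exact_mod_cast hd₂
  have hlL : l ≤ L := by rw [hL]; exact le_add_of_nonneg_right (by positivity)
  have hL₀ : 0 < L := hl.trans_le hlL
  have hβL : β * (4 * d₂ * L) ≤ 1 := (le_div_iff₀ (by positivity)).1 hβ
  have hβl : l * β * d₂ ≤ 1 / 4 := by
    have : β * (4 * d₂ * l) ≤ β * (4 * d₂ * L) := by gcongr
    linarith
  have hβl' : β * l ≤ 1 / 4 := by
    have : l * β * 1 ≤ l * β * d₂ := by gcongr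
    linarith
  have hαL : α * (10 * d₁ * L) ≤ 1 := (le_div_iff₀ (by positivity)).1 (hα.trans (min_le_right _ _))
  have hαl : α * d₁ * (3 * (l + l ^ 2 / μ) + 5 / 4 * l) ≤ 3 / 5 := by
    -- The model constant of Φ is l + l²/μ, larger than L, but 6L = 6l + 3l²/μ still dominates; then
    -- α ≤ 1/(10 d₁ L) gives 3/5.
    have h1 : 3 * (l + l ^ 2 / μ) + 5 / 4 * l ≤ 6 * L := by
      have e : l ^ 2 / (2 * μ) = l ^ 2 / μ / 2 := by field_simp
      rw [hL, e]
      linarith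
    calc _ ≤ α * d₁ * (6 * L) := by gcongr
      _ ≤ _ := by linarith
  have hαβ : α * (32 * (l / μ) ^ 2) ≤ β := by
    rw [← hκ]
    exact (le_div_iff₀ (by rw [hκ]; positivity)).1 (hα.trans (min_le_left _ _))
  have hθ₀ : 0 < θ₁ := by rw [hθ₁]; positivity
  have hμ₁₀ : 0 < μ₁ := by rw [hμ₁]; positivity
  have hμ₂₀ : 0 < μ₂ := by rw [hμ₂]; positivity
  have hnoise₁ : 13 / 25 * (α * d₁ * (l ^ 2 * μ₁ ^ 2)) ≤ 13 / 150 * (α * ε ^ 2) := by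
    have h1 : μ₁ ^ 2 * (4 * θ₁) = α * ε ^ 2 := by
      rw [hμ₁, div_pow, mul_pow, mul_pow, Real.sq_sqrt hα₀.le, Real.sq_sqrt hθ₀.le]
      field_simp
      norm_num
    -- Only the summand 3/(2α) of θ₁ is needed.
    have h2 : 3 / 2 * α * (d₁ * l ^ 2) ≤ θ₁ := by
      have e : 3 / 2 * α * (d₁ ^ 2 * L ^ 2) = 3 / (2 * α) * d₁ ^ 2 * L ^ 2 * α ^ 2 := by
        field_simp
      calc 3 / 2 * α * (d₁ * l ^ 2) ≤ 3 / 2 * α * (d₁ ^ 2 * L ^ 2) := by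
            gcongr
            exact le_self_pow₀ hd₁' two_ne_zero
        _ ≤ θ₁ := by
            rw [e, hθ₁]
            gcongr
            have : 0 ≤ 5 * d₁ * L + 3 / 2 * L + d₂ * L := by positivity
            linarith
    have h3 : μ₁ ^ 2 * (4 * (3 / 2 * α * (d₁ * l ^ 2))) ≤ μ₁ ^ 2 * (4 * θ₁) := by gcongr
    linarith
  have hnoise₂ : 5 / 16 * (β * d₂ * (l ^ 2 * μ₂ ^ 2)) ≤ 5 / 48 * (α * ε ^ 2) := by
    have h1 : 3 * β * (d₂ ^ 2 * L ^ 2 * μ₂ ^ 2) = α * ε ^ 2 := by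
      rw [hμ₂, div_pow, mul_pow, mul_pow, mul_pow, Real.sq_sqrt hα₀.le,
        Real.sq_sqrt (by positivity : 0 ≤ 3 * β)]
      field_simp
    have h2 : 3 * β * (d₂ * l ^ 2 * μ₂ ^ 2) ≤ 3 * β * (d₂ ^ 2 * L ^ 2 * μ₂ ^ 2) := by
      gcongr
      exact le_self_pow₀ hd₂' two_ne_zero
    linarith
  let Z : ℕ → Ω → EuclideanSpace ℝ (Fin d₁) × EuclideanSpace ℝ (Fin d₂) := fun t ω =>
    zoAGDA f α β μ₁ μ₂ x₀ y₀ (fun s => u s ω) (fun s => v s ω) t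
  have hxZ : ∀ t ω, x t ω = (Z t ω).1 := hx
  have hstep := integral_zoAGDA_succ_le (ε := ε) hd₁ hd₂ hsmooth hPL hl hμ hα₀ hβ₀ hβl hβl' hαl hαβ
    hμ₁₀ hμ₂₀ x₀ y₀ hu_meas hv_meas hu_law hv_law hu_indep hv_indep huv_indep (Z := Z)
    fun _ _ => rfl
  have hΦc := (differentiable_primalFun hsmooth hPL hμ).continuous
  have hVi : ∀ t, Integrable (fun ω => 3 * primalFun f (Z t ω).1 - f (Z t ω).1 (Z t ω).2) P :=
    fun t =>
      have hc := continuous_zoAGDA hsmooth α β μ₁ μ₂ x₀ y₀ t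
      integrable_of_continuous_directions hu_meas hv_meas hu_law hv_law
        (((hΦc.comp hc.fst).const_mul 3).sub (hsmooth.differentiable.continuous.comp hc))
  have hV : ∀ t, 2 * Φstar ≤
      ∫ ω, (3 * primalFun f (Z t ω).1 - f (Z t ω).1 (Z t ω).2) ∂P := fun t => by
    have h := integral_mono (integrable_const (μ := P) (2 * Φstar)) (hVi t) fun ω => by
      have h1 := hΦstar.2 (Set.mem_range_self (Z t ω).1)
      have h2 := hPL.le_primalFun (Z t ω).1 (Z t ω).2
      dsimp only
      linarith
    simpa using h
  refine ⟨differentiable_primalFun hsmooth hPL hμ, fun t => ?_, ?_⟩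
  · simp only [hxZ]
    exact integrable_norm_gradient_primalFun_zoAGDA hsmooth hPL hl hμ x₀ y₀ hu_meas hv_meas hu_law
      hv_law t
  · simp only [hxZ]
    have hαε : 0 < α * ε ^ 2 := by positivity
    obtain ⟨T, hT, hTle⟩ := exists_isLeast_and_le_of_decrease
      (a := fun t => ∫ ω, ‖gradient (primalFun f) (Z t ω).1‖ ∂P)
      (ε := ε) (δ := α * ε ^ 2 / 4) (by positivity) hV fun t ht => by
        -- The drop is at least αε² minus the noise (13/150 + 5/48) αε², hence more than αε²/4.
        have h1 : 2 * α * ε * ε ≤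
            2 * α * ε * ∫ ω, ‖gradient (primalFun f) (Z t ω).1‖ ∂P := by gcongr
        linarith [hstep t]
    refine ⟨T, hT, hTle.trans_eq ?_⟩
    simp only [Z, zoAGDA, integral_const, probReal_univ, one_smul]
    field_simp
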